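/- Let $\delta\le\kappa$ be uncountable cardinals. A filter (always assumed proper) is called $\mu$-complete if it is closed under intersections of fewer than $\mu$ of its members. The cardinal $\kappa$ is $\delta$-strongly compact if, for every set $A$, every $\kappa$-complete filter over $A$ can be extended to a $\delta$-complete ultrafilter over $A$. An ultrafilter $U$ over a cardinal $\lambda$ is uniform if $|X|=\lambda$ for every $X\in U$. Then $\kappa$ is $\delta$-strongly compact if and only if for every regular cardinal $\lambda\ge\kappa$ there exists a $\delta$-complete uniform ultrafilter over $\lambda$. -/

import Mathlib

universe u

open Cardinal

/-- A filter `F` over a set `A` is uniform if every member of `F` has the cardinality of `A`.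
For `A` a cardinal `l`, this says that every `X ∈ F` has cardinality `l`. -/
def IsUniformFilter {A : Type u} (F : Filter A) : Prop :=
  ∀ X ∈ F, #X = #A

/-- `κ` is `δ`-strongly compact: over every set `A`, every (proper) `κ`-complete filter
can be extended to a `δ`-complete ultrafilter. A filter is `c`-complete if it is closed under
intersections of fewer than `c` of its members, which is Mathlib's `CardinalInterFilter _ c`,
and `↑U ≤ F` says that every member of `F` belongs to `U`. -/
def IsStronglyCompactFor (δ κ : Cardinal.{u}) : Prop :=
  ∀ (A : Type u) (F : Filter A), F.NeBot → CardinalInterFilter F κ →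
    ∃ U : Ultrafilter A, (U : Filter A) ≤ F ∧ CardinalInterFilter (U : Filter A) δ

section UltrafilterBind

variable {A : Type u} {B : Type u} {c : Cardinal.{u}}

/-! Forward: extend the tail filter on `l`; sets of size below `l` are bounded, so the extension is
uniform. Backward: take `l` regular, above `κ` and the size of the filter, and a Ketonen-minimal
`δ`-complete ultrafilter on `l` containing all tails. Minimality makes it weakly normal and
concentrated on points of cofinality below `κ`. Small cofinal sets `C a` then meet `l` many disjoint
intervals almost everywhere, which yields `l` large sets with fewer than `κ` through each point.
Indexing the filter by these sets, send `a` to a common point of the fewer than `κ` members it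
selects, and push forward. -/

theorem Ultrafilter.mem_bind_iff (D : Ultrafilter A) (W : A → Ultrafilter B) (s : Set B) :
    s ∈ D.bind W ↔ ∀ᶠ a in (D : Filter A), s ∈ W a :=
  Iff.rfl

theorem CardinalInterFilter.ultrafilter_bind (D : Ultrafilter A) (W : A → Ultrafilter B)
    (hD : CardinalInterFilter (D : Filter A) c)
    (hW : ∀ a, CardinalInterFilter (W a : Filter B) c) :
    CardinalInterFilter (D.bind W : Filter B) c := by
  refine ⟨fun S hSc hS => ?_⟩
  have h : ∀ᶠ a in (D : Filter A), ∀ s, ∀ _ : s ∈ S, s ∈ W a :=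
    (Filter.eventually_cardinal_ball (p := fun a s _ => s ∈ W a) hSc).2 hS
  exact (Ultrafilter.mem_bind_iff D W _).2
    (h.mono fun a ha => (hW a).cardinal_sInter_mem S hSc ha)

theorem CardinalInterFilter.ultrafilter_pure (a : A) :
    CardinalInterFilter ((pure a : Ultrafilter A) : Filter A) c :=
  ⟨fun _ _ hS => Ultrafilter.mem_pure.2 (Set.mem_sInter.2 fun s hs => Ultrafilter.mem_pure.1 (hS s hs))⟩

end UltrafilterBind

section KetonenOrder

variable {L : Type u} [LinearOrder L]

/-- The Ketonen order: `E` is below `D` if `E` is the `D`-limit of countably complete ultrafilters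
`W a` with `W a` concentrating on the predecessors of `a`. -/
def KetonenLT (E D : Ultrafilter L) : Prop :=
  ∃ W : L → Ultrafilter L,
    (∀ᶠ a in (D : Filter L), Set.Iio a ∈ W a ∧ CountableInterFilter (W a : Filter L)) ∧
      E = D.bind W

/-- A descending chain in the Ketonen order restricts to descending chains starting with the
ultrafilters `W a` that witness its first step. -/
theorem KetonenLT.exists_chain_of_chain {D : ℕ → Ultrafilter L}
    (hD : CountableInterFilter (D 0 : Filter L)) (h : ∀ n, KetonenLT (D (n + 1)) (D n))
    {s : Set L} (hs : s ∈ D 0) :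
    ∃ a ∈ s, ∃ E : ℕ → Ultrafilter L, CountableInterFilter (E 0 : Filter L) ∧
      (∀ n, KetonenLT (E (n + 1)) (E n)) ∧ Set.Iio a ∈ E 0 := by
  choose W hW hbind using h
  let E : L → ℕ → Ultrafilter L := fun a =>
    Nat.rec (W 0 a) fun n P => P.bind (W (n + 1))
  have hE : ∀ n, D (n + 1) = (D 0).bind fun a => E a n := by
    intro n
    induction n with
    | zero => exact hbind 0
    | succ n ih =>
      rw [hbind (n + 1), ih]
      rfl
  -- Countable completeness lets one `a` serve all steps of the chain at once.
  have hall : ∀ᶠ a in (D 0 : Filter L), ∀ n, ∀ᶠ b in (E a n).toFilter,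
      Set.Iio b ∈ W (n + 1) b ∧ CountableInterFilter (W (n + 1) b : Filter L) := by
    rw [eventually_countable_forall]
    intro n
    have := hW (n + 1)
    rw [hE n] at this
    exact this
  obtain ⟨a, has, ha, ha0, hcc⟩ := ((Filter.Eventually.and hs (hall.and (hW 0)))).exists
  exact ⟨a, has, E a, hcc, fun n => ⟨W (n + 1), ha n, rfl⟩, ha0⟩

/-- A chain concentrating below `a` yields one concentrating below some `b < a`, an infinite descent
in `L`. -/
theorem KetonenLT.not_chain [WellFoundedLT L] (D : ℕ → Ultrafilter L)
    (hD : CountableInterFilter (D 0 : Filter L)) (h : ∀ n, KetonenLT (D (n + 1)) (D n)) :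
    False := by
  have key : ∀ a : L, ∀ D : ℕ → Ultrafilter L, CountableInterFilter (D 0 : Filter L) →
      (∀ n, KetonenLT (D (n + 1)) (D n)) → Set.Iio a ∉ D 0 := by
    intro a
    induction a using WellFoundedLT.induction with
    | _ a ih =>
      intro D hD h hs
      obtain ⟨b, hb, E, hE, hE', hbE⟩ := KetonenLT.exists_chain_of_chain hD h hs
      exact ih b hb E hE hE' hbE
  obtain ⟨a, -, E, hE, hE', haE⟩ :=
    KetonenLT.exists_chain_of_chain hD h (s := Set.univ) Filter.univ_mem
  exact key a E hE hE' haE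

theorem exists_ketonenLT_minimal [WellFoundedLT L] (P : Ultrafilter L → Prop)
    (hP : ∀ U, P U → CountableInterFilter (U : Filter L)) (hne : ∃ U, P U) :
    ∃ U, P U ∧ ∀ E, P E → ¬ KetonenLT E U := by
  by_contra! hcon
  have hwf : WellFounded fun E U : Ultrafilter L => KetonenLT E U ∧ P U := by
    rw [wellFounded_iff_isEmpty_descending_chain]
    exact ⟨fun ⟨D, hD⟩ => KetonenLT.not_chain D (hP _ (hD 0).2) fun n => (hD n).1⟩
  obtain ⟨U, hU, hmin⟩ := hwf.has_min {U | P U} hne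
  obtain ⟨E, hE, hlt⟩ := hcon U hU
  exact hmin E hE ⟨hlt, hU⟩

end KetonenOrder

section UniformUltrafilters

variable {δ κ : Cardinal.{u}}

theorem IsUniformFilter.Ici_mem {l : Cardinal.{u}} {U : Ultrafilter l.ord.ToType}
    (hU : IsUniformFilter (U : Filter l.ord.ToType)) (i : l.ord.ToType) : Set.Ici i ∈ U := by
  by_contra h
  rw [← Ultrafilter.compl_mem_iff_notMem, Set.compl_Ici] at h
  have h1 := hU _ h
  have h2 := Cardinal.mk_Iio_lt i (by simp)
  exact h2.ne h1

theorem exists_forall_lt_of_mk_lt_cof {L : Type u} [LinearOrder L] {s : Set L}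
    (hs : #s < Order.cof L) : ∃ b, ∀ x ∈ s, x < b := by
  have h : ¬ IsCofinal s := fun h => (Order.cof_le h).not_gt hs
  simpa [IsCofinal] using h

/-- If the cofinality of the set of predecessors of `a` is a regular cardinal carrying a
`δ`-complete uniform ultrafilter, then some `δ`-complete ultrafilter concentrates on the final
segments of this set. -/
theorem exists_ultrafilter_concentrating_below {L : Type u} [LinearOrder L] [WellFoundedLT L]
    (a : L)
    (h : ∃ U : Ultrafilter (Order.cof (Set.Iio a)).ord.ToType,
      CardinalInterFilter (U : Filter (Order.cof (Set.Iio a)).ord.ToType) δ ∧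
        IsUniformFilter (U : Filter (Order.cof (Set.Iio a)).ord.ToType)) :
    ∃ W : Ultrafilter L, CardinalInterFilter (W : Filter L) δ ∧ Set.Iio a ∈ W ∧
      ∀ b < a, Set.Ici b ∈ W := by
  obtain ⟨U, hc, hu⟩ := h
  obtain ⟨s, hs, hst⟩ := Ordinal.exists_ord_cof_eq (Set.Iio a)
  rw [← Ordinal.type_toType (Order.cof (Set.Iio a)).ord, Ordinal.type_eq] at hst
  obtain ⟨e⟩ := hst
  let f : (Order.cof (Set.Iio a)).ord.ToType → L := fun i => (e.symm i).1.1
  refine ⟨U.map f, ?_, ?_, fun b hb => ?_⟩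
  · rw [Ultrafilter.coe_map]
    infer_instance
  · exact Filter.mem_map.2 (Filter.univ_mem' fun i => (e.symm i).1.2)
  · obtain ⟨y, hy, hby⟩ := hs ⟨b, hb⟩
    refine Filter.mem_map.2 (Filter.mem_of_superset (hu.Ici_mem (e ⟨y, hy⟩)) fun i hi => ?_)
    have h1 : (⟨y, hy⟩ : s) ≤ e.symm i := by
      rw [← not_lt]
      intro hlt
      have := e.map_rel_iff.2 hlt
      rw [RelIso.apply_symm_apply] at this
      exact (not_lt.2 hi) this
    exact le_trans (show b ≤ y.1 from hby) h1

/-- A Ketonen-minimal uniform ultrafilter: it is weakly normal and concentrates on points of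
cofinality below `κ`. -/
theorem exists_weaklyNormal_ultrafilter (hδ : ℵ₀ < δ) (hδκ : δ ≤ κ)
    (h : ∀ l : Cardinal.{u}, l.IsRegular → κ ≤ l →
      ∃ U : Ultrafilter l.ord.ToType, CardinalInterFilter (U : Filter l.ord.ToType) δ ∧
        IsUniformFilter (U : Filter l.ord.ToType))
    {l : Cardinal.{u}} (hl : l.IsRegular) (hκl : κ ≤ l) :
    ∃ U : Ultrafilter l.ord.ToType, CardinalInterFilter (U : Filter l.ord.ToType) δ ∧
      (∀ b, Set.Ioi b ∈ U) ∧
      (∀ g : l.ord.ToType → l.ord.ToType, (∀ᶠ a in (U : Filter l.ord.ToType), g a < a) →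
        ∃ b, ∀ᶠ a in (U : Filter l.ord.ToType), g a < b) ∧
      ∀ᶠ a in (U : Filter l.ord.ToType), Order.cof (Set.Iio a) < κ := by
  have hcc : ∀ V : Ultrafilter l.ord.ToType, CardinalInterFilter (V : Filter l.ord.ToType) δ →
      CountableInterFilter (V : Filter l.ord.ToType) := fun V hV =>
    CardinalInterFilter.toCountableInterFilter (V : Filter l.ord.ToType) hδ
  have := Cardinal.noMaxOrder hl.aleph0_le
  obtain ⟨U, ⟨hU, hfin⟩, hmin⟩ := exists_ketonenLT_minimal
    (fun V : Ultrafilter l.ord.ToType =>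
      CardinalInterFilter (V : Filter l.ord.ToType) δ ∧ ∀ b, Set.Ici b ∈ V)
    (fun V hV => hcc V hV.1)
    (let ⟨V, hV, hu⟩ := h l hl hκl; ⟨V, hV, hu.Ici_mem⟩)
  have hIoi : ∀ b, Set.Ioi b ∈ U := fun b =>
    let ⟨c, hc⟩ := exists_gt b
    Filter.mem_of_superset (hfin c) fun x hx => lt_of_lt_of_le hc hx
  refine ⟨U, hU, hIoi, fun g hg => ?_, ?_⟩
  -- If `g` is unbounded, its pushforward still contains all tails and lies below `U`.
  · by_contra! hcon
    refine hmin (U.bind fun a => pure (g a))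
      ⟨CardinalInterFilter.ultrafilter_bind U _ hU
        fun a => CardinalInterFilter.ultrafilter_pure (g a), hcon⟩
      ⟨_, hg.mono fun a ha => ⟨ha, hcc _ (CardinalInterFilter.ultrafilter_pure (g a))⟩, rfl⟩
  · by_contra hcon
    rw [← Ultrafilter.eventually_not] at hcon
    -- Where the cofinality is below `κ`, a `U`-null set under `hcon`, `pure a` is only a default.
    have hW : ∀ a : l.ord.ToType, ∃ W : Ultrafilter l.ord.ToType,
        CardinalInterFilter (W : Filter l.ord.ToType) δ ∧
          (¬ Order.cof (Set.Iio a) < κ → Set.Iio a ∈ W ∧ ∀ b < a, Set.Ici b ∈ W) := by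
      intro a
      by_cases ha : Order.cof (Set.Iio a) < κ
      · exact ⟨pure a, CardinalInterFilter.ultrafilter_pure a, fun h => absurd ha h⟩
      · have hκa := not_lt.1 ha
        have hreg : (Order.cof (Set.Iio a)).IsRegular :=
          ⟨hδ.le.trans (hδκ.trans hκa), (Order.cof_ord_cof _).ge⟩
        obtain ⟨W, hWc, hW⟩ := exists_ultrafilter_concentrating_below a (h _ hreg hκa)
        exact ⟨W, hWc, fun _ => hW⟩
    choose W hWc hW using hW
    refine hmin (U.bind W) ⟨CardinalInterFilter.ultrafilter_bind U W hU hWc, fun b => ?_⟩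
      ⟨W, hcon.mono fun a ha => ⟨(hW a ha).1, hcc _ (hWc a)⟩, rfl⟩
    exact (Ultrafilter.mem_bind_iff U W _).2
      ((hcon.and (hIoi b)).mono fun a ha => (hW a ha.1).2 b ha.2)

/-- Well-founded recursion, bounding earlier values by regularity. It makes the intervals `[g i, f
(g i))` pairwise disjoint. -/
theorem exists_forall_lt_map_le {l : Cardinal.{u}} (hl : l.IsRegular)
    (f : l.ord.ToType → l.ord.ToType) :
    ∃ g : l.ord.ToType → l.ord.ToType, ∀ i j, j < i → f (g j) ≤ g i := by
  have hb : ∀ (i : l.ord.ToType) (p : Set.Iio i → l.ord.ToType), ∃ b, ∀ j, f (p j) ≤ b := by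
    intro i p
    obtain ⟨b, hb⟩ := exists_forall_lt_of_mk_lt_cof (s := Set.range fun j => f (p j)) (by
      rw [Ordinal.cof_toType, hl.cof_ord]
      exact Cardinal.mk_range_le.trans_lt (by simpa using Cardinal.mk_Iio_lt i (by simp)))
    exact ⟨b, fun j => (hb _ ⟨j, rfl⟩).le⟩
  choose B hB using hb
  let g : l.ord.ToType → l.ord.ToType :=
    WellFounded.fix (wellFounded_lt (α := l.ord.ToType)) fun i p => B i fun j => p j.1 j.2
  refine ⟨g, fun i j hj => ?_⟩
  have hg : g i = B i fun j => g j.1 := WellFounded.fix_eq _ _ i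
  rw [hg]
  exact hB i (fun j => g j.1) ⟨j, hj⟩

/-- A `δ`-complete ultrafilter together with `l` many of its members such that each point lies in
fewer than `κ` of them. -/
theorem exists_regular_ultrafilter (hδ : ℵ₀ < δ) (hδκ : δ ≤ κ)
    (h : ∀ l : Cardinal.{u}, l.IsRegular → κ ≤ l →
      ∃ U : Ultrafilter l.ord.ToType, CardinalInterFilter (U : Filter l.ord.ToType) δ ∧
        IsUniformFilter (U : Filter l.ord.ToType))
    {l : Cardinal.{u}} (hl : l.IsRegular) (hκl : κ ≤ l) :
    ∃ U : Ultrafilter l.ord.ToType, CardinalInterFilter (U : Filter l.ord.ToType) δ ∧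
      ∃ X : l.ord.ToType → Set l.ord.ToType, (∀ i, X i ∈ U) ∧ ∀ a, #{i | a ∈ X i} < κ := by
  obtain ⟨U, hU, hIoi, hnormal, hcof⟩ := exists_weaklyNormal_ultrafilter hδ hδκ h hl hκl
  have hC : ∀ a : l.ord.ToType, ∃ c : Set l.ord.ToType, #c < κ ∧
      (Order.cof (Set.Iio a) < κ → c ⊆ Set.Iio a ∧ ∀ b < a, ∃ x ∈ c, b ≤ x) := by
    intro a
    by_cases ha : Order.cof (Set.Iio a) < κ
    · obtain ⟨s, hs, hsc⟩ := Order.exists_cof_eq (Set.Iio a)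
      refine ⟨Subtype.val '' s, Cardinal.mk_image_le.trans_lt (hsc ▸ ha), fun _ => ⟨?_, ?_⟩⟩
      · rintro _ ⟨x, -, rfl⟩
        exact x.2
      · intro b hb
        obtain ⟨y, hy, hby⟩ := hs ⟨b, hb⟩
        exact ⟨y.1, ⟨y, hy, rfl⟩, hby⟩
    · exact ⟨∅, by simpa using Cardinal.aleph0_pos.trans (hδ.trans_le hδκ), fun h => absurd h ha⟩
  choose C hCκ hC using hC
  have hnext : ∀ b, ∃ b', ∀ᶠ a in (U : Filter l.ord.ToType), ∃ x ∈ C a, b ≤ x ∧ x < b' := by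
    intro b
    have hex : ∀ᶠ a in (U : Filter l.ord.ToType), ∃ x, x ∈ C a ∧ b ≤ x ∧ x < a := by
      filter_upwards [hcof, hIoi b] with a ha hba
      obtain ⟨hsub, hx⟩ := hC a ha
      obtain ⟨x, hxC, hbx⟩ := hx b hba
      exact ⟨x, hxC, hbx, hsub hxC⟩
    have hg : ∃ g : l.ord.ToType → l.ord.ToType, ∀ a, (∃ x, x ∈ C a ∧ b ≤ x ∧ x < a) →
        g a ∈ C a ∧ b ≤ g a ∧ g a < a := by
      have : Nonempty l.ord.ToType := ⟨b⟩
      exact ⟨fun a => Classical.epsilon fun x => x ∈ C a ∧ b ≤ x ∧ x < a,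
        fun a ha => Classical.epsilon_spec ha⟩
    obtain ⟨g, hg⟩ := hg
    obtain ⟨b', hb'⟩ := hnormal g (hex.mono fun a ha => (hg a ha).2.2)
    exact ⟨b', (hex.and hb').mono fun a ha => ⟨g a, (hg a ha.1).1, (hg a ha.1).2.1, ha.2⟩⟩
  choose f hf using hnext
  obtain ⟨g, hg⟩ := exists_forall_lt_map_le hl f
  refine ⟨U, hU, fun i => {a | ∃ x ∈ C a, g i ≤ x ∧ x < f (g i)}, fun i => hf (g i), fun a => ?_⟩
  refine lt_of_le_of_lt ?_ (hCκ a)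
  -- Disjoint intervals have distinct witnesses in `C a`, so at most `#(C a)` indices occur.
  choose p hpC hp1 hp2 using
    fun i : {i | a ∈ {a | ∃ x ∈ C a, g i ≤ x ∧ x < f (g i)}} => i.2
  refine Cardinal.mk_le_of_injective (f := fun i => (⟨p i, hpC i⟩ : C a)) fun i j hij => ?_
  have hij' : p i = p j := congrArg Subtype.val hij
  rcases lt_trichotomy i.1 j.1 with hlt | heq | hlt
  · exact absurd ((hp2 i).trans_le ((hg _ _ hlt).trans (hp1 j))) hij'.not_lt
  · exact Subtype.ext heq
  · exact absurd ((hp2 j).trans_le ((hg _ _ hlt).trans (hp1 i))) hij'.symm.not_lt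

theorem isStronglyCompactFor_of_uniform (hδ : ℵ₀ < δ) (hδκ : δ ≤ κ)
    (h : ∀ l : Cardinal.{u}, l.IsRegular → κ ≤ l →
      ∃ U : Ultrafilter l.ord.ToType, CardinalInterFilter (U : Filter l.ord.ToType) δ ∧
        IsUniformFilter (U : Filter l.ord.ToType)) :
    IsStronglyCompactFor δ κ := by
  intro A F hF hFκ
  let l : Cardinal.{u} := Order.succ (max κ #F.sets)
  have hl : l.IsRegular :=
    Cardinal.isRegular_succ ((hδ.le.trans hδκ).trans (le_max_left _ _))
  have hκl : κ ≤ l := (le_max_left _ _).trans (Order.le_succ _)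
  obtain ⟨U, hU, X, hXU, hX⟩ := exists_regular_ultrafilter hδ hδκ h hl hκl
  have hcard : #F.sets ≤ #l.ord.ToType := by
    rw [Cardinal.mk_toType, Cardinal.card_ord]
    exact (le_max_right _ _).trans (Order.le_succ _)
  obtain ⟨e⟩ := hcard
  have hx : ∀ a, ∃ x : A, ∀ s : F.sets, a ∈ X (e s) → x ∈ s.1 := by
    intro a
    have hlt : #{s : F.sets | a ∈ X (e s)} < κ := by
      refine lt_of_le_of_lt ?_ (hX a)
      refine Cardinal.mk_le_of_injective
        (f := fun s : {s : F.sets | a ∈ X (e s)} => (⟨e s.1, s.2⟩ : {i | a ∈ X i})) ?_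
      intro s t hst
      exact Subtype.ext (e.injective (congrArg Subtype.val hst))
    have hmem : (⋂ s : {s : F.sets | a ∈ X (e s)}, s.1.1) ∈ F :=
      (Filter.cardinal_iInter_mem hlt).2 fun s => s.1.2
    obtain ⟨x, hx⟩ := hF.nonempty_of_mem hmem
    exact ⟨x, fun s hs => Set.mem_iInter.1 hx ⟨s, hs⟩⟩
  choose f hf using hx
  refine ⟨U.map f, fun s hs => ?_, ?_⟩
  · exact Filter.mem_map.2 (Filter.mem_of_superset (hXU (e ⟨s, hs⟩)) fun a ha => hf a ⟨s, hs⟩ ha)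
  · rw [Ultrafilter.coe_map]
    infer_instance

theorem exists_uniform_of_isStronglyCompactFor (h : IsStronglyCompactFor δ κ)
    {l : Cardinal.{u}} (hl : l.IsRegular) (hκl : κ ≤ l) :
    ∃ U : Ultrafilter l.ord.ToType, CardinalInterFilter (U : Filter l.ord.ToType) δ ∧
      IsUniformFilter (U : Filter l.ord.ToType) := by
  have hmk : #l.ord.ToType = l := by simp
  have := Cardinal.noMaxOrder hl.aleph0_le
  have : Nonempty l.ord.ToType := Cardinal.mk_ne_zero_iff.1 (by rw [hmk]; exact hl.ne_zero)
  have hcomplete : CardinalInterFilter (Filter.atTop : Filter l.ord.ToType) κ := by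
    refine ⟨fun S hS hmem => ?_⟩
    choose! b hb using fun s hs => Filter.mem_atTop_sets.1 (hmem s hs)
    obtain ⟨c, hc⟩ := exists_forall_lt_of_mk_lt_cof (s := b '' S) (by
      rw [Ordinal.cof_toType, hl.cof_ord]
      exact Cardinal.mk_image_le.trans_lt (hS.trans_le hκl))
    exact Filter.mem_atTop_sets.2 ⟨c, fun x hx => Set.mem_sInter.2 fun s hs =>
      hb s hs x ((hc _ ⟨s, hs, rfl⟩).le.trans hx)⟩
  obtain ⟨U, hUle, hU⟩ := h l.ord.ToType Filter.atTop inferInstance hcomplete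
  refine ⟨U, hU, fun s hs => (Cardinal.mk_set_le s).antisymm (not_lt.1 fun hlt => ?_)⟩
  obtain ⟨b, hb⟩ := exists_forall_lt_of_mk_lt_cof (s := s) (by
    rw [Ordinal.cof_toType, hl.cof_ord]
    exact hlt.trans_eq hmk)
  obtain ⟨x, hxs, hbx⟩ := U.nonempty_of_mem (Filter.inter_mem hs (hUle (Filter.Ici_mem_atTop b)))
  exact (hb x hxs).not_ge hbx

end UniformUltrafilters

theorem theorem1p2 (δ κ : Cardinal.{u}) (hδ : ℵ₀ < δ) (hδκ : δ ≤ κ) :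
    IsStronglyCompactFor δ κ ↔
      ∀ l : Cardinal.{u}, l.IsRegular → κ ≤ l →
        ∃ U : Ultrafilter l.ord.ToType,
          CardinalInterFilter (U : Filter l.ord.ToType) δ ∧
            IsUniformFilter (U : Filter l.ord.ToType) :=
  ⟨fun h _ hl hκl => exists_uniform_of_isStronglyCompactFor h hl hκl,
    isStronglyCompactFor_of_uniform hδ hδκ⟩
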